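/- Let $\mathcal S'_+$ be the space of tempered distributions on $\mathbb R$ with support in $[0,\infty)$, regarded as a topological subspace of $\mathcal S'(\mathbb R)$ with its strong dual topology (uniform convergence on bounded subsets of $\mathcal S(\mathbb R)$). For $\alpha>0$ let $f_\alpha(x)=H(x)\,x^{\alpha-1}/\Gamma(\alpha)$, where $H$ is the Heaviside function, and for $\alpha\le 0$ let $f_\alpha=\frac{d^N}{dx^N}f_{\alpha+N}$ in the sense of distributions, where $N\in\mathbb N$ is any integer with $\alpha+N>0$. For $\alpha\in\mathbb R$ and $y\in\mathcal S'_+$ put $D^\alpha y=f_{-\alpha}*y\in\mathcal S'_+$, where $*$ is the convolution in $\mathcal S'_+$. Then: (a) For each fixed $\alpha\in\mathbb R$, the map $y\mapsto D^\alpha y$ is linear and continuous from $\mathcal S'_+$ to $\mathcal S'_+$. (b) For each fixed $y\in\mathcal S'_+$, the map $\alpha\mapsto D^\alpha y$ is a smooth map from $\mathbb R$ to $\mathcal S'_+$, i.e. it has derivatives of all orders, as limits of difference quotients in $\mathcal S'_+$. (c) The map $(\alpha,y)\mapsto D^\alpha y$ is (jointly) continuous from $\mathbb R\times\mathcal S'_+$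 to $\mathcal S'_+$. -/

import Mathlib

open scoped SchwartzMap ContDiff Topology
open Filter

namespace FracDeriv

noncomputable section

/-- A smooth cutoff: `0` on `(-∞, -2]`, `1` on `[-1, ∞)`. -/
def cutoff (x : ℝ) : ℂ := (Real.smoothTransition (x + 2) : ℂ)

theorem cutoff_eq_zero {x : ℝ} (hx : x ≤ -2) : cutoff x = 0 := by
  simp [cutoff, Real.smoothTransition.zero_of_nonpos (show x + 2 ≤ 0 by linarith)]

theorem cutoff_eq_one {x : ℝ} (hx : -1 ≤ x) : cutoff x = 1 := by
  simp [cutoff, Real.smoothTransition.one_of_one_le (show 1 ≤ x + 2 by linarith)]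

theorem cutoff_contDiff : ContDiff ℝ ∞ cutoff :=
  Complex.ofRealCLM.contDiff.comp (Real.smoothTransition.contDiff.comp (by fun_prop))

theorem cutoff_hasTemperateGrowth : cutoff.HasTemperateGrowth := by
  have hd : HasCompactSupport (fderiv ℝ cutoff) := by
    refine HasCompactSupport.intro (K := Set.Icc (-2 : ℝ) (-1)) isCompact_Icc fun x hx ↦ ?_
    rw [Set.mem_Icc, not_and_or, not_le, not_le] at hx
    rcases hx with hx | hx
    · have : cutoff =ᶠ[𝓝 x] fun _ ↦ 0 := by
        filter_upwards [Iio_mem_nhds hx] with y hy using cutoff_eq_zero (le_of_lt hy)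
      rw [this.fderiv_eq]; simp
    · have : cutoff =ᶠ[𝓝 x] fun _ ↦ 1 := by
        filter_upwards [Ioi_mem_nhds hx] with y hy using cutoff_eq_one (le_of_lt hy)
      rw [this.fderiv_eq]; simp
  refine .of_fderiv (hd.hasTemperateGrowth (cutoff_contDiff.fderiv_right (by simp)))
    (cutoff_contDiff.differentiable (by simp)) (k := 0) (C := 1) fun x ↦ ?_
  simp [cutoff, abs_of_nonneg (Real.smoothTransition.nonneg _), Real.smoothTransition.le_one]

theorem norm_iteratedFDeriv_cutoff_mul_le (n : ℕ) : ∃ (m : ℕ) (C : ℝ), 0 ≤ C ∧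
    ∀ (g : ℝ → ℂ), ContDiff ℝ ∞ g → ∀ (x M : ℝ), 0 ≤ M →
      (-2 ≤ x → ∀ j ≤ n, ‖iteratedFDeriv ℝ j g x‖ ≤ M) →
      ‖iteratedFDeriv ℝ n (fun y ↦ cutoff y * g y) x‖ ≤ C * (1 + ‖x‖) ^ m * M := by
  obtain ⟨m, C, hC, h⟩ := cutoff_hasTemperateGrowth.norm_iteratedFDeriv_le_uniform n
  refine ⟨m, 2 ^ n * C, by positivity, fun g hg x M hM hgM ↦ ?_⟩
  rcases lt_or_ge x (-2) with hx | hx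
  · have : (fun y ↦ cutoff y * g y) =ᶠ[𝓝 x] fun _ ↦ 0 := by
      filter_upwards [Iio_mem_nhds hx] with y hy
      simp [cutoff_eq_zero (le_of_lt hy)]
    rw [(this.iteratedFDeriv ℝ n).eq_of_nhds]
    simp only [iteratedFDeriv_fun_zero, Pi.zero_apply, norm_zero]
    positivity
  · refine (norm_iteratedFDeriv_mul_le cutoff_contDiff hg x (n := n)
      (by exact_mod_cast le_top)).trans ?_
    calc _ ≤ ∑ i ∈ Finset.range (n + 1), (n.choose i : ℝ) * (C * (1 + ‖x‖) ^ m) * M := by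
          refine Finset.sum_le_sum fun i hi ↦ ?_
          have hi' : i ≤ n := Nat.lt_succ_iff.mp (Finset.mem_range.mp hi)
          have h1 := h i hi' x
          have h2 := hgM hx (n - i) (Nat.sub_le _ _)
          gcongr
      _ = _ := by
          rw [← Finset.sum_mul, ← Finset.sum_mul, ← Nat.cast_sum, Nat.sum_range_choose]
          push_cast; ring

/-- The Schwartz function `t ↦ cutoff t * φ (x + t)`. -/
def slice (x : ℝ) : 𝓢(ℝ, ℂ) →L[ℂ] 𝓢(ℝ, ℂ) :=
  SchwartzMap.smulLeftCLM ℂ cutoff ∘L SchwartzMap.compSubConstCLM ℂ (-x)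

theorem slice_apply (x : ℝ) (φ : 𝓢(ℝ, ℂ)) (t : ℝ) : slice x φ t = cutoff t * φ (x + t) := by
  simp [slice, cutoff_hasTemperateGrowth, add_comm]

theorem weight_le {x t : ℝ} (hx : -2 ≤ x) (ht : -2 ≤ t) :
    1 + ‖x‖ ≤ 4 * (1 + ‖x + t‖) ∧ 1 + ‖t‖ ≤ 4 * (1 + ‖x + t‖) := by
  simp only [Real.norm_eq_abs]
  have h0 := abs_nonneg (x + t)
  have h1 := le_abs_self (x + t)
  constructor
  · rcases abs_cases x with h | h <;> linarith
  · rcases abs_cases t with h | h <;> linarith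

theorem seminorm_slice_le (k a b : ℕ) : ∃ (s : Finset (ℕ × ℕ)) (C : ℝ), 0 ≤ C ∧
    ∀ (φ : 𝓢(ℝ, ℂ)) (x : ℝ), -2 ≤ x → (1 + ‖x‖) ^ k * SchwartzMap.seminorm ℂ a b (slice x φ) ≤
      C * s.sup (schwartzSeminormFamily ℂ ℝ ℂ) φ := by
  obtain ⟨m, C, hC, h⟩ := norm_iteratedFDeriv_cutoff_mul_le b
  set N := k + a + m with hN
  refine ⟨Finset.Iic (N, b), 4 ^ N * C * 2 ^ N, by positivity, fun φ x hx ↦ ?_⟩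
  set P := (Finset.Iic (N, b)).sup (schwartzSeminormFamily ℂ ℝ ℂ) φ with hP
  have hP0 : 0 ≤ P := apply_nonneg _ _
  have hbd : ∀ t : ℝ, (1 + ‖x‖) ^ k * (‖t‖ ^ a * ‖iteratedFDeriv ℝ b (slice x φ) t‖) ≤
      4 ^ N * C * 2 ^ N * P := by
    intro t
    have hfun : (slice x φ : ℝ → ℂ) = fun t ↦ cutoff t * φ (x + t) := funext (slice_apply x φ)
    rw [hfun]
    rcases lt_or_ge t (-2) with ht | ht
    · have h0 := h (fun t ↦ φ (x + t)) ((φ.smooth ⊤).comp (by fun_prop)) t 0 le_rfl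
        (fun h ↦ absurd h (by linarith))
      have h1 : ‖iteratedFDeriv ℝ b (fun t ↦ cutoff t * φ (x + t)) t‖ = 0 :=
        le_antisymm (by simpa using h0) (norm_nonneg _)
      rw [h1]; simp only [mul_zero]; positivity
    · have h0 := h (fun t ↦ φ (x + t)) ((φ.smooth ⊤).comp (by fun_prop)) t
        (2 ^ N * P / (1 + ‖x + t‖) ^ N) (by positivity) (by
          intro _ j hj
          rw [iteratedFDeriv_comp_add_left, le_div_iff₀ (by positivity), mul_comm]
          exact SchwartzMap.one_add_le_sup_seminorm_apply (𝕜 := ℂ) (m := (N, b)) le_rfl hj φ (x + t))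
      obtain ⟨w1, w2⟩ := weight_le hx ht
      have w3 : ‖t‖ ≤ 4 * (1 + ‖x + t‖) := le_trans (by linarith) w2
      calc _ ≤ (4 * (1 + ‖x + t‖)) ^ k * ((4 * (1 + ‖x + t‖)) ^ a *
            (C * (4 * (1 + ‖x + t‖)) ^ m * (2 ^ N * P / (1 + ‖x + t‖) ^ N))) := by
            grw [h0, w1, w3, w2]
        _ = _ := by
            rw [hN]; simp only [mul_pow, pow_add]; field_simp
  have h0 : 0 < (1 + ‖x‖) ^ k := by positivity
  rw [mul_comm, ← le_div_iff₀ h0]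
  refine SchwartzMap.seminorm_le_bound ℂ a b _ (by positivity) fun t ↦ ?_
  rw [le_div_iff₀ h0, mul_comm]
  exact hbd t

theorem exists_seminorm_bound (u : 𝓢(ℝ, ℂ) →L[ℂ] ℂ) : ∃ (s : Finset (ℕ × ℕ)) (C : ℝ), 0 ≤ C ∧
    ∀ φ, ‖u φ‖ ≤ C * s.sup (schwartzSeminormFamily ℂ ℝ ℂ) φ := by
  obtain ⟨s, C, -, h⟩ := Seminorm.bound_of_continuous (schwartz_withSeminorms ℂ ℝ ℂ)
    ((normSeminorm ℂ ℂ).comp u.toLinearMap) (u.continuous.norm)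
  exact ⟨s, C, C.2, fun φ ↦ h φ⟩

theorem finset_sup_le_sum (s : Finset (ℕ × ℕ)) (φ : 𝓢(ℝ, ℂ)) :
    s.sup (schwartzSeminormFamily ℂ ℝ ℂ) φ ≤ ∑ i ∈ s, SchwartzMap.seminorm ℂ i.1 i.2 φ := by
  have := Seminorm.finset_sup_le_sum (schwartzSeminormFamily ℂ ℝ ℂ) s φ
  have h2 : (∑ i ∈ s, schwartzSeminormFamily ℂ ℝ ℂ i) φ =
      ∑ i ∈ s, SchwartzMap.seminorm ℂ i.1 i.2 φ := by
    rw [← FunLike.coeAddMonoidHom_apply, map_sum, Finset.sum_apply]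
    rfl
  rwa [h2] at this

theorem norm_apply_slice_le (u : 𝓢(ℝ, ℂ) →L[ℂ] ℂ) (k : ℕ) :
    ∃ (s : Finset (ℕ × ℕ)) (C : ℝ), 0 ≤ C ∧ ∀ (φ : 𝓢(ℝ, ℂ)) (x : ℝ), -2 ≤ x →
      (1 + ‖x‖) ^ k * ‖u (slice x φ)‖ ≤ C * s.sup (schwartzSeminormFamily ℂ ℝ ℂ) φ := by
  classical
  obtain ⟨s, C, hC, h⟩ := exists_seminorm_bound u
  choose S D hD hSD using seminorm_slice_le k
  refine ⟨s.biUnion fun i ↦ S i.1 i.2, C * ∑ i ∈ s, D i.1 i.2,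
    mul_nonneg hC (Finset.sum_nonneg fun i _ ↦ hD _ _), fun φ x hx ↦ ?_⟩
  calc _ ≤ (1 + ‖x‖) ^ k * (C * ∑ i ∈ s, SchwartzMap.seminorm ℂ i.1 i.2 (slice x φ)) := by
        grw [h (slice x φ), finset_sup_le_sum]
    _ = C * ∑ i ∈ s, (1 + ‖x‖) ^ k * SchwartzMap.seminorm ℂ i.1 i.2 (slice x φ) := by
        rw [Finset.mul_sum, Finset.mul_sum, Finset.mul_sum]
        exact Finset.sum_congr rfl fun i _ ↦ by ring
    _ ≤ C * ∑ i ∈ s, D i.1 i.2 *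
          (s.biUnion fun i ↦ S i.1 i.2).sup (schwartzSeminormFamily ℂ ℝ ℂ) φ := by
        refine mul_le_mul_of_nonneg_left (Finset.sum_le_sum fun i hi ↦ ?_) hC
        refine (hSD i.1 i.2 φ x hx).trans ?_
        refine mul_le_mul_of_nonneg_left ?_ (hD _ _)
        exact Seminorm.le_def.1 (Finset.sup_mono (Finset.subset_biUnion_of_mem
          (fun i : ℕ × ℕ ↦ S i.1 i.2) hi)) φ
    _ = _ := by rw [← Finset.sum_mul, mul_assoc]


theorem iteratedDeriv_eq_iterate (φ : 𝓢(ℝ, ℂ)) (n : ℕ) :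
    iteratedDeriv n φ = ((SchwartzMap.derivCLM ℂ ℂ)^[n] φ : 𝓢(ℝ, ℂ)) := by
  induction n with
  | zero => simp
  | succ n ih =>
    rw [iteratedDeriv_succ, ih, Function.iterate_succ_apply']
    rfl

theorem norm_taylor_le (φ : 𝓢(ℝ, ℂ)) {K h y : ℝ} 
    (hK : ∀ s ∈ Set.uIcc 0 h, ‖deriv (deriv φ) (y + s)‖ ≤ K) :
    ‖φ (y + h) - φ y - (h : ℂ) * deriv φ y‖ ≤ K * |h| ^ 2 := by
  have hφ1 (z : ℝ) : HasDerivAt φ (deriv φ z) z := φ.hasDerivAt z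
  have hφ2 (z : ℝ) : HasDerivAt (deriv φ) (deriv (deriv φ) z) z :=
    (SchwartzMap.derivCLM ℂ ℂ φ).hasDerivAt z
  have hconv : Convex ℝ (Set.uIcc 0 h) := convex_uIcc 0 h
  have hK0 : 0 ≤ K := (norm_nonneg _).trans (hK 0 Set.left_mem_uIcc)
  have hb (s : ℝ) (hs : s ∈ Set.uIcc 0 h) : |s| ≤ |h| := by
    simpa using Set.abs_sub_left_of_mem_uIcc hs
  have h1 (s : ℝ) (hs : s ∈ Set.uIcc 0 h) : ‖deriv φ (y + s) - deriv φ y‖ ≤ K * |h| := by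
    have := hconv.norm_image_sub_le_of_norm_hasDerivWithin_le (f := fun s ↦ deriv φ (y + s))
      (fun s _ ↦ ((hφ2 (y + s)).comp_const_add y s).hasDerivWithinAt) hK
      Set.left_mem_uIcc hs
    simp only [add_zero, sub_zero, Real.norm_eq_abs] at this
    exact this.trans (mul_le_mul_of_nonneg_left (hb s hs) hK0)
  have := hconv.norm_image_sub_le_of_norm_hasDerivWithin_le
      (f := fun s ↦ φ (y + s) - (s : ℂ) * deriv φ y)
      (f' := fun s ↦ deriv φ (y + s) - deriv φ y)
      (fun s _ ↦ (((hφ1 (y + s)).comp_const_add y s).sub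
        (by simpa using (Complex.ofRealCLM.hasDerivAt (x := s)).mul_const (deriv φ y))).hasDerivWithinAt)
      h1 Set.left_mem_uIcc Set.right_mem_uIcc
  simp only [add_zero, sub_zero, Real.norm_eq_abs, Complex.ofReal_zero, zero_mul] at this
  calc _ = ‖φ (y + h) - (h : ℂ) * deriv φ y - φ y‖ := by ring_nf
    _ ≤ _ := this
    _ = _ := by ring

/-- Remainder of first order of translation in the space of Schwartz functions. -/
def transRem (x h : ℝ) : 𝓢(ℝ, ℂ) →L[ℂ] 𝓢(ℝ, ℂ) :=
  SchwartzMap.compSubConstCLM ℂ (-(x + h)) - SchwartzMap.compSubConstCLM ℂ (-x)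
    - (h : ℂ) • (SchwartzMap.compSubConstCLM ℂ (-x) ∘L SchwartzMap.derivCLM ℂ ℂ)

theorem transRem_apply (x h : ℝ) (φ : 𝓢(ℝ, ℂ)) (t : ℝ) :
    transRem x h φ t = φ (x + t + h) - φ (x + t) - (h : ℂ) * deriv φ (x + t) := by
  simp [transRem]
  ring_nf

theorem derivCLM_transRem (x h : ℝ) (φ : 𝓢(ℝ, ℂ)) :
    SchwartzMap.derivCLM ℂ ℂ (transRem x h φ) = transRem x h (SchwartzMap.derivCLM ℂ ℂ φ) := by
  have hφ1 (z : ℝ) : HasDerivAt φ (deriv φ z) z := φ.hasDerivAt z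
  have hφ2 (z : ℝ) : HasDerivAt (deriv φ) (deriv (deriv φ) z) z :=
    (SchwartzMap.derivCLM ℂ ℂ φ).hasDerivAt z
  ext t
  have hf : (transRem x h φ : ℝ → ℂ) =
      fun t ↦ φ ((x + h) + t) - φ (x + t) - (h : ℂ) * deriv φ (x + t) := by
    ext t; rw [transRem_apply]; ring_nf
  rw [SchwartzMap.derivCLM_apply, transRem_apply, hf]
  have := ((((hφ1 (x + h + t)).comp_const_add (x + h) t).sub
    ((hφ1 (x + t)).comp_const_add x t)).sub
    (((hφ2 (x + t)).comp_const_add x t).const_mul (h : ℂ))).deriv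
  refine this.trans ?_
  have e : (SchwartzMap.derivCLM ℂ ℂ φ : ℝ → ℂ) = deriv φ := rfl
  rw [e]; ring_nf

theorem iterate_derivCLM_transRem (n : ℕ) (x h : ℝ) (φ : 𝓢(ℝ, ℂ)) :
    (SchwartzMap.derivCLM ℂ ℂ)^[n] (transRem x h φ) =
      transRem x h ((SchwartzMap.derivCLM ℂ ℂ)^[n] φ) := by
  induction n with
  | zero => rfl
  | succ n ih => rw [Function.iterate_succ_apply', ih, derivCLM_transRem,
      Function.iterate_succ_apply']

theorem seminorm_transRem_le (a b : ℕ) (x : ℝ) (φ : 𝓢(ℝ, ℂ)) : ∃ C : ℝ, 0 ≤ C ∧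
    ∀ h : ℝ, |h| ≤ 1 → SchwartzMap.seminorm ℂ a b (transRem x h φ) ≤ C * |h| ^ 2 := by
  set ψ := (SchwartzMap.derivCLM ℂ ℂ)^[b] φ with hψ
  set P := 2 ^ a * (Finset.Iic (a, 2)).sup (fun m ↦ SchwartzMap.seminorm ℂ m.1 m.2) ψ with hP
  have hP0 : 0 ≤ P := mul_nonneg (by positivity) (apply_nonneg _ _)
  refine ⟨(1 + |x|) ^ a * 2 ^ a * P, by positivity, fun h hh ↦ ?_⟩
  refine SchwartzMap.seminorm_le_bound' ℂ a b _ (by positivity) fun t ↦ ?_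
  rw [iteratedDeriv_eq_iterate, iterate_derivCLM_transRem, ← hψ, transRem_apply]
  set y := x + t with hy
  have h1 : ‖ψ (y + h) - ψ y - (h : ℂ) * deriv ψ y‖ ≤ 2 ^ a * P / (1 + |y|) ^ a * |h| ^ 2 := by
    refine norm_taylor_le ψ fun s hs ↦ ?_
    have hs' : |s| ≤ 1 := (by simpa using Set.abs_sub_left_of_mem_uIcc hs : |s| ≤ |h|).trans hh
    have h2 := SchwartzMap.one_add_le_sup_seminorm_apply (𝕜 := ℂ) (m := (a, 2)) le_rfl le_rfl ψ
      (y + s)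
    rw [norm_iteratedFDeriv_eq_norm_iteratedDeriv, iteratedDeriv_succ, iteratedDeriv_one,
      ← hP, Real.norm_eq_abs] at h2
    rw [le_div_iff₀ (by positivity)]
    have h3 : 1 + |y| ≤ 2 * (1 + |y + s|) := by
      have : |y| ≤ |y + s| + |s| := by simpa using abs_sub (y + s) s
      have := abs_nonneg (y + s)
      linarith
    calc _ ≤ ‖deriv (deriv ψ) (y + s)‖ * (2 * (1 + |y + s|)) ^ a := by gcongr
      _ = 2 ^ a * ((1 + |y + s|) ^ a * ‖deriv (deriv ψ) (y + s)‖) := by rw [mul_pow]; ring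
      _ ≤ _ := by gcongr
  have h4 : |t| ≤ (1 + |x|) * (1 + |y|) := by
    have : |t| ≤ |y| + |x| := by simpa [hy] using abs_sub y x
    nlinarith [abs_nonneg x, abs_nonneg y]
  calc _ ≤ ((1 + |x|) * (1 + |y|)) ^ a * (2 ^ a * P / (1 + |y|) ^ a * |h| ^ 2) := by gcongr
    _ = _ := by rw [mul_pow]; field_simp

theorem hasDerivAt_apply_translate (w : 𝓢(ℝ, ℂ) →L[ℂ] ℂ) (φ : 𝓢(ℝ, ℂ)) (x : ℝ) :
    HasDerivAt (fun x : ℝ ↦ w (SchwartzMap.compSubConstCLM ℂ (-x) φ))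
      (w (SchwartzMap.compSubConstCLM ℂ (-x) (SchwartzMap.derivCLM ℂ ℂ φ))) x := by
  obtain ⟨s, C, hC, hw⟩ := exists_seminorm_bound w
  choose D hD hDle using fun a b ↦ seminorm_transRem_le a b x φ
  rw [hasDerivAt_iff_isLittleO_nhds_zero]
  refine Asymptotics.IsBigO.trans_isLittleO (g := fun h : ℝ ↦ h ^ 2) ?_ ?_
  · refine Asymptotics.IsBigO.of_bound (C * ∑ i ∈ s, D i.1 i.2) ?_
    filter_upwards [Metric.closedBall_mem_nhds (0 : ℝ) one_pos] with h hh
    have hh' : |h| ≤ 1 := by simpa using hh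
    have e : w (SchwartzMap.compSubConstCLM ℂ (-(x + h)) φ) -
        w (SchwartzMap.compSubConstCLM ℂ (-x) φ) -
        h • w (SchwartzMap.compSubConstCLM ℂ (-x) (SchwartzMap.derivCLM ℂ ℂ φ)) =
        w (transRem x h φ) := by
      simp [transRem]
    rw [e]
    calc _ ≤ C * ∑ i ∈ s, D i.1 i.2 * |h| ^ 2 := by
          refine (hw _).trans (mul_le_mul_of_nonneg_left ((finset_sup_le_sum _ _).trans ?_) hC)
          exact Finset.sum_le_sum fun i _ ↦ hDle i.1 i.2 h hh'
      _ = _ := by rw [← Finset.sum_mul, norm_pow, Real.norm_eq_abs, mul_assoc]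
  · simpa using Asymptotics.isLittleO_pow_pow (𝕜 := ℝ) (m := 1) (n := 2) (by norm_num)

theorem hasDerivAt_apply_slice (u : 𝓢(ℝ, ℂ) →L[ℂ] ℂ) (φ : 𝓢(ℝ, ℂ)) (x : ℝ) :
    HasDerivAt (fun x : ℝ ↦ u (slice x φ)) (u (slice x (SchwartzMap.derivCLM ℂ ℂ φ))) x :=
  hasDerivAt_apply_translate (u ∘L SchwartzMap.smulLeftCLM ℂ cutoff) φ x

theorem iteratedDeriv_apply_slice (u : 𝓢(ℝ, ℂ) →L[ℂ] ℂ) (φ : 𝓢(ℝ, ℂ)) (n : ℕ) :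
    iteratedDeriv n (fun x : ℝ ↦ u (slice x φ)) =
      fun x : ℝ ↦ u (slice x ((SchwartzMap.derivCLM ℂ ℂ)^[n] φ)) := by
  induction n with
  | zero => simp
  | succ n ih =>
    rw [iteratedDeriv_succ, ih, Function.iterate_succ_apply']
    exact funext fun x ↦ (hasDerivAt_apply_slice u _ x).deriv

theorem contDiff_apply_slice (u : 𝓢(ℝ, ℂ) →L[ℂ] ℂ) (φ : 𝓢(ℝ, ℂ)) :
    ContDiff ℝ ∞ (fun x : ℝ ↦ u (slice x φ)) := by
  refine contDiff_of_differentiable_iteratedDeriv fun n _ ↦ ?_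
  rw [iteratedDeriv_apply_slice]
  exact fun x ↦ (hasDerivAt_apply_slice u _ x).differentiableAt

theorem seminorm_iterate_derivCLM_le (k l j : ℕ) (φ : 𝓢(ℝ, ℂ)) :
    SchwartzMap.seminorm ℂ k l ((SchwartzMap.derivCLM ℂ ℂ)^[j] φ) ≤
      SchwartzMap.seminorm ℂ k (l + j) φ := by
  refine SchwartzMap.seminorm_le_bound' ℂ k l _ (apply_nonneg _ _) fun x ↦ ?_
  rw [iteratedDeriv_eq_iterate, ← Function.iterate_add_apply, ← iteratedDeriv_eq_iterate]
  exact SchwartzMap.le_seminorm' ℂ k (l + j) φ x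

theorem exists_iterate_bound (s : Finset (ℕ × ℕ)) (n : ℕ) : ∃ S : Finset (ℕ × ℕ),
    ∀ j ≤ n, ∀ φ : 𝓢(ℝ, ℂ),
      s.sup (schwartzSeminormFamily ℂ ℝ ℂ) ((SchwartzMap.derivCLM ℂ ℂ)^[j] φ) ≤
        s.card * S.sup (schwartzSeminormFamily ℂ ℝ ℂ) φ := by
  classical
  refine ⟨(s ×ˢ Finset.range (n + 1)).image fun p ↦ (p.1.1, p.1.2 + p.2), fun j hj φ ↦ ?_⟩
  rw [← nsmul_eq_mul]
  refine (finset_sup_le_sum _ _).trans (Finset.sum_le_card_nsmul _ _ _ fun i hi ↦ ?_)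
  refine (seminorm_iterate_derivCLM_le _ _ _ _).trans ?_
  have hmem : (i.1, i.2 + j) ∈
      (s ×ˢ Finset.range (n + 1)).image fun p ↦ (p.1.1, p.1.2 + p.2) :=
    Finset.mem_image.2 ⟨(i, j), by simp [hi, Nat.lt_succ_of_le hj], rfl⟩
  exact Seminorm.le_def.1 (Finset.le_sup (f := schwartzSeminormFamily ℂ ℝ ℂ) hmem) φ

theorem convTest_bound (u : 𝓢(ℝ, ℂ) →L[ℂ] ℂ) (p : ℕ × ℕ) :
    ∃ (s : Finset (ℕ × ℕ)) (C : ℝ), 0 ≤ C ∧ ∀ (φ : 𝓢(ℝ, ℂ)) (x : ℝ),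
      ‖x‖ ^ p.1 * ‖iteratedFDeriv ℝ p.2 (fun x ↦ cutoff x * u (slice x φ)) x‖ ≤
        C * s.sup (schwartzSeminormFamily ℂ ℝ ℂ) φ := by
  obtain ⟨k, n⟩ := p
  obtain ⟨m, C, hC, h⟩ := norm_iteratedFDeriv_cutoff_mul_le n
  obtain ⟨s, D, hD, hs⟩ := norm_apply_slice_le u (k + m)
  obtain ⟨S, hS⟩ := exists_iterate_bound s n
  refine ⟨S, C * (D * s.card), by positivity, fun φ x ↦ ?_⟩
  set P := S.sup (schwartzSeminormFamily ℂ ℝ ℂ) φ with hP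
  have hP0 : 0 ≤ P := apply_nonneg _ _
  have h1 := h _ (contDiff_apply_slice u φ) x (D * (s.card * P) / (1 + ‖x‖) ^ (k + m))
    (by positivity) (by
      intro hx j hj
      rw [norm_iteratedFDeriv_eq_norm_iteratedDeriv, iteratedDeriv_apply_slice,
        le_div_iff₀ (by positivity), mul_comm]
      exact (hs _ x hx).trans (mul_le_mul_of_nonneg_left (hS j hj φ) hD))
  calc _ ≤ (1 + ‖x‖) ^ k * (C * (1 + ‖x‖) ^ m * (D * (s.card * P) / (1 + ‖x‖) ^ (k + m))) := by
        refine mul_le_mul ?_ h1 (norm_nonneg _) (by positivity)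
        gcongr
        linarith
    _ = _ := by rw [pow_add]; field_simp

/-- The Schwartz function `x ↦ cutoff x * ⟨u(t), cutoff t * φ (x + t)⟩`, as a continuous linear
function of `φ`. -/
def convTest (u : 𝓢(ℝ, ℂ) →L[ℂ] ℂ) : 𝓢(ℝ, ℂ) →L[ℂ] 𝓢(ℝ, ℂ) :=
  SchwartzMap.mkCLM (fun φ x ↦ cutoff x * u (slice x φ))
    (fun f g x ↦ by simp [mul_add])
    (fun a f x ↦ by simp; ring)
    (fun φ ↦ cutoff_contDiff.mul (contDiff_apply_slice u φ))
    (convTest_bound u)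

theorem convTest_apply (u : 𝓢(ℝ, ℂ) →L[ℂ] ℂ) (φ : 𝓢(ℝ, ℂ)) (x : ℝ) :
    convTest u φ x = cutoff x * u (slice x φ) := rfl

/-- The space `𝒮'₊` of tempered distributions on `ℝ` with support in `[0, ∞)`, a subspace of the
topological dual of the Schwartz space with its strong topology (uniform convergence on bounded
sets of Schwartz functions), which is the topology that Mathlib puts on `𝓢(ℝ, ℂ) →L[ℂ] ℂ`.
The support condition says that `u` vanishes on every Schwartz function supported in `(-∞, 0)`. -/
def TemperedPlus : Submodule ℂ (𝓢(ℝ, ℂ) →L[ℂ] ℂ) where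
  carrier := {u | Distribution.IsVanishingOn u (Set.Iio (0 : ℝ))}
  add_mem' {u v} hu hv φ hφ := by
    rw [add_apply, hu φ hφ, hv φ hφ, add_zero]
  zero_mem' _ _ := rfl
  smul_mem' c u hu φ hφ := by
    rw [smul_apply, hu φ hφ, smul_zero]

theorem comp_convTest_mem {u v : 𝓢(ℝ, ℂ) →L[ℂ] ℂ} (hu : u ∈ TemperedPlus)
    (hv : v ∈ TemperedPlus) : v ∘L convTest u ∈ TemperedPlus := by
  intro φ hφ
  refine hv _ ?_
  obtain ⟨δ, hδ, hball⟩ := Metric.isOpen_iff.1 (isClosed_tsupport φ).isOpen_compl 0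
    (fun h ↦ lt_irrefl (0 : ℝ) (hφ h))
  have hφ0 (y : ℝ) (hy : -δ < y) : φ y = 0 := by
    rcases lt_or_ge y 0 with h | h
    · exact image_eq_zero_of_notMem_tsupport (hball (by simpa [abs_of_neg h] using by linarith))
    · exact image_eq_zero_of_notMem_tsupport fun h' ↦ absurd (hφ h') (not_lt.2 h)
  refine Set.Subset.trans (closure_minimal (t := Set.Iic (-δ)) ?_ isClosed_Iic)
    (Set.Iic_subset_Iio.2 (by linarith))
  intro x hx
  by_contra hx'
  rw [Set.mem_Iic, not_le] at hx'
  refine hx ?_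
  change cutoff x * u (slice x φ) = 0
  rw [hu _ ?_, mul_zero]
  refine Set.Subset.trans (closure_minimal (t := Set.Iic (-δ - x)) ?_ isClosed_Iic)
    (Set.Iic_subset_Iio.2 (by linarith))
  intro t ht
  by_contra ht'
  rw [Set.mem_Iic, not_le] at ht'
  refine ht ?_
  rw [slice_apply, hφ0 (x + t) (by linarith), mul_zero]

/-- The convolution `u * v` of `u, v ∈ 𝒮'₊`:
`⟨u * v, φ⟩ = ⟨v(x), χ(x) ⟨u(t), χ(t) φ(x + t)⟩⟩`, where `χ` is the cutoff function above. As `χ = 1`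
near `[0, ∞)`, this does not depend on `χ`. -/
def conv (u v : TemperedPlus) : TemperedPlus :=
  ⟨v.1 ∘L convTest u.1, comp_convTest_mem u.2 v.2⟩

/-- The distributional derivative on `𝒮'₊`: `⟨u', φ⟩ = -⟨u, φ'⟩`. -/
def distDeriv (u : TemperedPlus) : TemperedPlus :=
  ⟨-(u.1 ∘L SchwartzMap.derivCLM ℂ ℂ), fun φ hφ ↦ by
    have := u.2 _ ((SchwartzMap.tsupport_derivCLM_subset ℂ φ).trans hφ)
    simpa using this⟩

/-- An integrable majorant on `(0, ∞)`, used to show that `f_α` is tempered. -/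
def powMajorant (α : ℝ) (x : ℝ) : ℝ :=
  if x ≤ 1 then x ^ (α - 1) else x ^ (-2 : ℝ)

theorem integrableOn_powMajorant {α : ℝ} (hα : 0 < α) :
    MeasureTheory.IntegrableOn (powMajorant α) (Set.Ioi 0) := by
  rw [← Set.Ioc_union_Ioi_eq_Ioi zero_le_one]
  refine MeasureTheory.IntegrableOn.union ?_ ?_
  · refine (((intervalIntegrable_iff_integrableOn_Ioc_of_le zero_le_one).1
      (intervalIntegral.intervalIntegrable_rpow' (r := α - 1) (by linarith)))).congr_fun
      (fun x hx ↦ ?_) measurableSet_Ioc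
    simp [powMajorant, hx.2]
  · refine (integrableOn_Ioi_rpow_of_lt (a := -2) (by norm_num) one_pos).congr_fun
      (fun x hx ↦ ?_) measurableSet_Ioi
    simp [powMajorant, not_le.2 (Set.mem_Ioi.1 hx)]

theorem norm_rpow_smul_le (α : ℝ) : ∃ (s : Finset (ℕ × ℕ)) (C : ℝ), 0 ≤ C ∧
    ∀ (φ : 𝓢(ℝ, ℂ)) (x : ℝ), 0 < x →
      ‖((x ^ (α - 1) : ℝ) : ℂ) * φ x‖ ≤
        powMajorant α x * (C * s.sup (schwartzSeminormFamily ℂ ℝ ℂ) φ) := by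
  obtain ⟨N, hN⟩ := exists_nat_ge (α + 1)
  refine ⟨Finset.Iic (N, 0), 2 ^ N, by positivity, fun φ x hx ↦ ?_⟩
  have h := SchwartzMap.one_add_le_sup_seminorm_apply (𝕜 := ℂ) (m := (N, 0)) le_rfl le_rfl φ x
  rw [norm_iteratedFDeriv_zero, Real.norm_eq_abs, abs_of_pos hx] at h
  have hx0 : 0 ≤ x ^ (α - 1) := Real.rpow_nonneg hx.le _
  rw [norm_mul, Complex.norm_real, Real.norm_eq_abs, abs_of_nonneg hx0, powMajorant]
  split_ifs with h1
  · refine mul_le_mul_of_nonneg_left (le_trans ?_ h) hx0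
    exact le_mul_of_one_le_left (norm_nonneg _) (one_le_pow₀ (by linarith))
  · push Not at h1
    have h2 : x ^ (α - 1) ≤ x ^ (-2 : ℝ) * (1 + x) ^ N := by
      calc x ^ (α - 1) ≤ x ^ (-2 + (N : ℝ)) := Real.rpow_le_rpow_of_exponent_le h1.le (by linarith)
        _ = x ^ (-2 : ℝ) * x ^ N := by rw [Real.rpow_add hx, Real.rpow_natCast]
        _ ≤ _ := by gcongr; linarith
    calc _ ≤ x ^ (-2 : ℝ) * (1 + x) ^ N * ‖φ x‖ := by gcongr
      _ = x ^ (-2 : ℝ) * ((1 + x) ^ N * ‖φ x‖) := by ring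
      _ ≤ _ := mul_le_mul_of_nonneg_left h (by positivity)

theorem integrableOn_rpow_mul {α : ℝ} (hα : 0 < α) (φ : 𝓢(ℝ, ℂ)) :
    MeasureTheory.IntegrableOn (fun x : ℝ ↦ ((x ^ (α - 1) : ℝ) : ℂ) * φ x) (Set.Ioi 0) := by
  obtain ⟨s, C, -, h⟩ := norm_rpow_smul_le α
  refine MeasureTheory.Integrable.mono' ((integrableOn_powMajorant hα).mul_const _) ?_
    ((MeasureTheory.ae_restrict_iff' measurableSet_Ioi).2 (.of_forall (h φ)))
  exact ((Complex.measurable_ofReal.comp (by fun_prop)).mul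
    φ.continuous.measurable).aestronglyMeasurable

theorem integral_kernel_eq (α : ℝ) (φ : 𝓢(ℝ, ℂ)) :
    (∫ x in Set.Ioi (0 : ℝ), ((x ^ (α - 1) / Real.Gamma α : ℝ) : ℂ) * φ x) =
      ((Real.Gamma α : ℝ) : ℂ)⁻¹ *
        ∫ x in Set.Ioi (0 : ℝ), ((x ^ (α - 1) : ℝ) : ℂ) * φ x := by
  rw [← MeasureTheory.integral_const_mul]
  congr 1 with x
  push_cast
  ring

/-- For `α > 0`, the tempered distribution `H(x) x ^ (α - 1) / Γ(α)`, with `H` the Heaviside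
function. -/
def powDist (α : ℝ) (hα : 0 < α) : TemperedPlus :=
  ⟨SchwartzMap.mkCLMtoNormedSpace (𝕜 := ℂ) (σ := RingHom.id ℂ)
    (fun φ : 𝓢(ℝ, ℂ) ↦ ∫ x in Set.Ioi (0 : ℝ), ((x ^ (α - 1) / Real.Gamma α : ℝ) : ℂ) * φ x)
    (fun φ ψ ↦ by
      rw [integral_kernel_eq, integral_kernel_eq, integral_kernel_eq]
      simp only [add_apply, mul_add]
      rw [MeasureTheory.integral_add (integrableOn_rpow_mul hα φ) (integrableOn_rpow_mul hα ψ),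
        mul_add])
    (fun c φ ↦ by
      simp only [smul_apply, smul_eq_mul, RingHom.id_apply]
      rw [← MeasureTheory.integral_const_mul]
      congr 1 with x
      ring)
    (by
      obtain ⟨s, C, hC, h⟩ := norm_rpow_smul_le α
      have hm : 0 ≤ ∫ x in Set.Ioi (0 : ℝ), powMajorant α x :=
        MeasureTheory.setIntegral_nonneg measurableSet_Ioi fun x hx ↦ by
          rw [powMajorant]
          split_ifs <;> exact Real.rpow_nonneg (Set.mem_Ioi.1 hx).le _
      refine ⟨s, ‖((Real.Gamma α : ℝ) : ℂ)⁻¹‖ * (∫ x in Set.Ioi (0 : ℝ), powMajorant α x) * C,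
        by positivity, fun φ ↦ ?_⟩
      rw [integral_kernel_eq, norm_mul, mul_assoc, mul_assoc]
      refine mul_le_mul_of_nonneg_left ?_ (norm_nonneg _)
      rw [← MeasureTheory.integral_mul_const]
      exact MeasureTheory.norm_integral_le_of_norm_le ((integrableOn_powMajorant hα).mul_const _)
        ((MeasureTheory.ae_restrict_iff' measurableSet_Ioi).2 (.of_forall (h φ)))),
  fun φ hφ ↦ MeasureTheory.setIntegral_eq_zero_of_forall_eq_zero fun x hx ↦ by
    rw [image_eq_zero_of_notMem_tsupport fun h ↦ lt_asymm (Set.mem_Ioi.1 hx) (hφ h), mul_zero]⟩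

/-- The family `f_α`, `α ∈ ℝ`, in `𝒮'₊`: `f_α(x) = H(x) x ^ (α - 1) / Γ(α)` for `α > 0`, and `f_α` is
the `N`-th distributional derivative of `f_{α + N}` for `α ≤ 0`, where `N ∈ ℕ` satisfies `α + N > 0`.
All such `N` give the same distribution; here `N = ⌊-α⌋ + 1` is the least one. -/
def fracKernel (α : ℝ) : TemperedPlus :=
  if hα : 0 < α then powDist α hα
  else distDeriv^[⌊-α⌋₊ + 1] (powDist (α + (⌊-α⌋₊ + 1 : ℕ)) (by
    have := Nat.lt_floor_add_one (-α)
    push_cast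
    linarith))

/-- The operator `D^α y = f_{-α} * y` on `𝒮'₊`. -/
def fracDeriv (α : ℝ) (y : TemperedPlus) : TemperedPlus :=
  conv (fracKernel (-α)) y

/-- A curve `c : ℝ → E` in a topological vector space is smooth if it has derivatives of all orders:
`d n` is the `n`-th derivative of `c`, and every derivative is the limit of the difference quotients
`(d n s - d n t) / (s - t)` in the topology of `E`. -/
def SmoothCurve {E : Type*} [AddCommGroup E] [Module ℝ E] [TopologicalSpace E] (c : ℝ → E) : Prop :=
  ∃ d : ℕ → ℝ → E, d 0 = c ∧ ∀ n t, Tendsto (slope (d n) t) (𝓝[≠] t) (𝓝 (d (n + 1) t))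

end

end FracDeriv

/-! By definition `fracDeriv α y = y ∘ T_α`, where `T_α = convTest (fracKernel (-α))` is an operator
on Schwartz functions. All three claims thus follow from properties of the curve `α ↦ T_α` in the
space of operators, with the topology of uniform convergence on bounded sets.

The kernels `f_{-α}` become too singular to differentiate in `α` directly. Near a given `α` one
fixes a large `N` and writes `f_{-α}` as the `N`-th derivative of `f_{N-α}`, which is a function
(`iterate_distDeriv_fracKernel`). The derivative passes from the kernel to the test function
(`convTest_iterate_distDeriv`), so `N` only contributes a fixed operator. With `t = exp s` and after
division by a weight `(1 + t) ^ M`, the kernel `t ^ (z - 1) / Γ(z)` is a bounded continuous function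
of `s`, and it is holomorphic in `z` as an element of the Banach space `ℝ →ᵇ ℂ`
(`differentiableAt_kernelCurve`). The map from this Banach space to operators is linear and
continuous (`weightConv`). So `T_α` is locally the continuous linear image of a holomorphic curve.

Applying `y` gives (b), since holomorphy yields derivatives of every order at once. For (a),
composition with a fixed operator is continuous for the strong topology. For (c), the `T_α` with `α`
in a compact interval form a compact, hence bounded, set of operators, so together they map a
bounded set into one bounded set (`continuous_comp_curve`). -/

/-- A curve in a Hausdorff space that is smooth near every point is smooth. -/
theorem FracDeriv.SmoothCurve.of_locally {E : Type*} [AddCommGroup E] [Module ℝ E]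
    [TopologicalSpace E] [T2Space E] {c : ℝ → E}
    (h : ∀ t₀, ∃ U : Set ℝ, IsOpen U ∧ t₀ ∈ U ∧ ∃ d : ℕ → ℝ → E, (∀ t ∈ U, d 0 t = c t) ∧
      ∀ n, ∀ t ∈ U, Tendsto (slope (d n) t) (𝓝[≠] t) (𝓝 (d (n + 1) t))) :
    FracDeriv.SmoothCurve c := by
  choose U hU hmem d hd0 hd using h
  have slope_congr {f g : ℝ → E} {V : Set ℝ} (hV : IsOpen V) {t : ℝ} (ht : t ∈ V)
      (hfg : ∀ s ∈ V, f s = g s) : slope f t =ᶠ[𝓝[≠] t] slope g t := by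
    filter_upwards [mem_nhdsWithin_of_mem_nhds (hV.mem_nhds ht)] with s hs
    simp only [slope, hfg s hs, hfg t ht]
  -- Two local families agree on overlaps at every order: order `n + 1` is a limit of slopes of
  -- order `n`, and limits are unique.
  have key : ∀ n a b t, t ∈ U a → t ∈ U b → d a n t = d b n t := by
    intro n
    induction n with
    | zero => intro a b t ha hb; rw [hd0 a t ha, hd0 b t hb]
    | succ n ih =>
      intro a b t ha hb
      refine tendsto_nhds_unique (hd a n t ha) ((hd b n t hb).congr' ?_)
      exact slope_congr ((hU a).inter (hU b)) ⟨ha, hb⟩ fun s hs ↦ ih b a s hs.2 hs.1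
  -- The value at `t` is taken from the family chosen for `t` itself; `key` allows a single family
  -- to be used near `t`.
  refine ⟨fun n t ↦ d t n t, funext fun t ↦ hd0 t t (hmem t), fun n t ↦ ?_⟩
  refine (hd t n t (hmem t)).congr' ?_
  exact slope_congr (hU t) (hmem t) fun s hs ↦ key n t s s hs (hmem s)

/-- The image of a holomorphic curve in a Banach space under a continuous linear map has derivatives
of all orders along the real axis. -/
theorem tendsto_slope_map_iterate_deriv {X E : Type*} [NormedAddCommGroup X] [NormedSpace ℂ X]
    [CompleteSpace X] [AddCommGroup E] [Module ℝ E] [TopologicalSpace E] (P : X →L[ℝ] E)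
    {V : Set ℂ} (hV : IsOpen V) {γ : ℂ → X} (hγ : DifferentiableOn ℂ γ V) (n : ℕ) {t : ℝ}
    (ht : (t : ℂ) ∈ V) :
    Tendsto (slope (fun s : ℝ ↦ P (deriv^[n] γ s)) t) (𝓝[≠] t) (𝓝 (P (deriv^[n + 1] γ t))) := by
  have hdiff : ∀ n, DifferentiableOn ℂ (deriv^[n] γ) V := by
    intro n
    induction n with
    | zero => exact hγ
    | succ n ih => rw [Function.iterate_succ_apply']; exact ih.deriv hV
  have h1 : HasDerivAt (deriv^[n] γ) (deriv^[n + 1] γ t) t := by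
    rw [Function.iterate_succ_apply']
    exact ((hdiff n).differentiableAt (hV.mem_nhds ht)).hasDerivAt
  have h2 : HasDerivAt (fun s : ℝ ↦ deriv^[n] γ s) (deriv^[n + 1] γ t) t := by
    simpa [Function.comp_def] using h1.scomp_of_eq t Complex.ofRealCLM.hasDerivAt rfl
  refine ((P.continuous.tendsto _).comp (hasDerivAt_iff_tendsto_slope.1 h2)).congr fun s ↦ ?_
  simp [slope, map_smul, map_sub]

namespace FracDeriv

noncomputable section

open MeasureTheory Complex
open scoped BoundedContinuousFunction

/-! ### Bounds on `convTest u` that are uniform in the kernel `u` -/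

/-- Equicontinuous version of `norm_apply_slice_le`. -/
theorem norm_apply_slice_le_of_bound (s : Finset (ℕ × ℕ)) (k : ℕ) :
    ∃ (S : Finset (ℕ × ℕ)) (C : ℝ), 0 ≤ C ∧ ∀ (u : 𝓢(ℝ, ℂ) →L[ℂ] ℂ) (A : ℝ), 0 ≤ A →
      (∀ φ, ‖u φ‖ ≤ A * s.sup (schwartzSeminormFamily ℂ ℝ ℂ) φ) →
      ∀ (φ : 𝓢(ℝ, ℂ)) (x : ℝ), -2 ≤ x →
        (1 + ‖x‖) ^ k * ‖u (slice x φ)‖ ≤ A * (C * S.sup (schwartzSeminormFamily ℂ ℝ ℂ) φ) := by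
  classical
  choose S D hD hSD using seminorm_slice_le k
  refine ⟨s.biUnion fun i ↦ S i.1 i.2, ∑ i ∈ s, D i.1 i.2,
    Finset.sum_nonneg fun i _ ↦ hD _ _, fun u A hA h φ x hx ↦ ?_⟩
  calc _ ≤ (1 + ‖x‖) ^ k * (A * ∑ i ∈ s, SchwartzMap.seminorm ℂ i.1 i.2 (slice x φ)) := by
        grw [h (slice x φ), finset_sup_le_sum]
    _ = A * ∑ i ∈ s, (1 + ‖x‖) ^ k * SchwartzMap.seminorm ℂ i.1 i.2 (slice x φ) := by
        rw [Finset.mul_sum, Finset.mul_sum, Finset.mul_sum]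
        exact Finset.sum_congr rfl fun i _ ↦ by ring
    _ ≤ A * ∑ i ∈ s, D i.1 i.2 *
          (s.biUnion fun i ↦ S i.1 i.2).sup (schwartzSeminormFamily ℂ ℝ ℂ) φ := by
        refine mul_le_mul_of_nonneg_left (Finset.sum_le_sum fun i hi ↦ ?_) hA
        refine (hSD i.1 i.2 φ x hx).trans ?_
        refine mul_le_mul_of_nonneg_left ?_ (hD _ _)
        exact Seminorm.le_def.1 (Finset.sup_mono (Finset.subset_biUnion_of_mem
          (fun i : ℕ × ℕ ↦ S i.1 i.2) hi)) φ
    _ = _ := by rw [← Finset.sum_mul]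

/-- Equicontinuous version of `convTest_bound`. -/
theorem seminorm_convTest_le_of_bound (s : Finset (ℕ × ℕ)) (p : ℕ × ℕ) :
    ∃ (S : Finset (ℕ × ℕ)) (C : ℝ), 0 ≤ C ∧ ∀ (u : 𝓢(ℝ, ℂ) →L[ℂ] ℂ) (A : ℝ), 0 ≤ A →
      (∀ φ, ‖u φ‖ ≤ A * s.sup (schwartzSeminormFamily ℂ ℝ ℂ) φ) →
      ∀ φ : 𝓢(ℝ, ℂ), SchwartzMap.seminorm ℂ p.1 p.2 (convTest u φ) ≤
        A * (C * S.sup (schwartzSeminormFamily ℂ ℝ ℂ) φ) := by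
  obtain ⟨k, n⟩ := p
  obtain ⟨m, C, hC, h⟩ := norm_iteratedFDeriv_cutoff_mul_le n
  -- The decay `k + m` pays for the Schwartz weight, of exponent `k`, and for the growth bound on
  -- multiplication by the cutoff, of exponent `m`.
  obtain ⟨s', D, hD, hs⟩ := norm_apply_slice_le_of_bound s (k + m)
  obtain ⟨S, hS⟩ := exists_iterate_bound s' n
  refine ⟨S, C * (D * s'.card), by positivity, fun u A hA hu φ ↦ ?_⟩
  set P := S.sup (schwartzSeminormFamily ℂ ℝ ℂ) φ with hP
  have hP0 : 0 ≤ P := apply_nonneg _ _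
  refine SchwartzMap.seminorm_le_bound ℂ k n _ (by positivity) fun x ↦ ?_
  have h1 := h _ (contDiff_apply_slice u φ) x (A * (D * (s'.card * P)) / (1 + ‖x‖) ^ (k + m))
    (by positivity) (by
      intro hx j hj
      rw [norm_iteratedFDeriv_eq_norm_iteratedDeriv, iteratedDeriv_apply_slice,
        le_div_iff₀ (by positivity), mul_comm]
      refine (hs u A hA hu _ x hx).trans (mul_le_mul_of_nonneg_left ?_ hA)
      exact mul_le_mul_of_nonneg_left (hS j hj φ) hD)
  calc _ ≤ (1 + ‖x‖) ^ k *
        (C * (1 + ‖x‖) ^ m * (A * (D * (s'.card * P)) / (1 + ‖x‖) ^ (k + m))) := by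
        refine mul_le_mul ?_ h1 (norm_nonneg _) (by positivity)
        gcongr
        linarith
    _ = _ := by rw [pow_add]; field_simp

/-- A linear family of functionals `u g`, `g` in a normed space, that is bounded by one continuous
seminorm gives a continuous linear family of operators `convTest (u g)`, for the topology of
uniform convergence on bounded sets. -/
theorem continuous_of_convTest_bound {X : Type*} [NormedAddCommGroup X] [NormedSpace ℂ X]
    (L : X →ₗ[ℂ] (𝓢(ℝ, ℂ) →L[ℂ] 𝓢(ℝ, ℂ)))
    (hL : ∀ p : ℕ × ℕ, ∃ (S : Finset (ℕ × ℕ)) (C : ℝ), 0 ≤ C ∧ ∀ g φ,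
      SchwartzMap.seminorm ℂ p.1 p.2 (L g φ) ≤
        ‖g‖ * (C * S.sup (schwartzSeminormFamily ℂ ℝ ℂ) φ)) : Continuous L := by
  have hw := schwartz_withSeminorms ℂ ℝ ℂ
  refine continuous_of_continuousAt_zero L ?_
  rw [ContinuousAt, map_zero,
    (ContinuousLinearMap.hasBasis_nhds_zero_of_basis hw.hasBasis_zero_ball).tendsto_right_iff]
  rintro ⟨B, I, r⟩ ⟨hB, hr⟩
  choose S C hC hSC using hL
  choose R hR hBR using (hw.isVonNBounded_iff_finset_seminorm_bounded).1 hB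
  -- `K` dominates each term `C i * R (S i)`, and the summand `1` keeps it positive, so that the
  -- ball of radius `r / K` makes sense even for empty `I`.
  set K := 1 + ∑ i ∈ I, C i * R (S i) with hK
  have hterm (i : ℕ × ℕ) : 0 ≤ C i * R (S i) := mul_nonneg (hC i) (hR _).le
  have hK0 : 0 < K := add_pos_of_pos_of_nonneg one_pos (Finset.sum_nonneg fun i _ ↦ hterm i)
  filter_upwards [Metric.ball_mem_nhds (0 : X) (div_pos hr hK0)] with g hg φ hφ
  rw [mem_ball_zero_iff, lt_div_iff₀ hK0] at hg
  rw [Seminorm.mem_ball_zero]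
  refine Seminorm.finset_sup_apply_lt hr fun i hi ↦ lt_of_le_of_lt ?_ hg
  refine (hSC i g φ).trans (mul_le_mul_of_nonneg_left ?_ (norm_nonneg _))
  have h1 : C i * R (S i) ≤ ∑ i ∈ I, C i * R (S i) :=
    Finset.single_le_sum (f := fun i ↦ C i * R (S i)) (fun i _ ↦ hterm i) hi
  have h2 := mul_le_mul_of_nonneg_left (hBR (S i) φ hφ).le (hC i)
  linarith

/-! ### Kernels with a bounded density relative to a polynomial weight -/

/-- Of the `M + 2` powers of `1 + t` supplied by the seminorm of `φ`, `M` absorb the weight and two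
leave an integrable majorant. -/
theorem norm_weightDist_integrand_le (M : ℕ) (g : ℝ →ᵇ ℂ) (φ : 𝓢(ℝ, ℂ)) {t : ℝ} (ht : 0 < t) :
    ‖g (Real.log t) * (((1 + t) ^ M : ℝ) * φ t)‖ ≤
      (1 + ‖t‖) ^ (-2 : ℝ) * (‖g‖ * (2 ^ (M + 2) *
        (Finset.Iic (M + 2, 0)).sup (schwartzSeminormFamily ℂ ℝ ℂ) φ)) := by
  have h := SchwartzMap.one_add_le_sup_seminorm_apply (𝕜 := ℂ) (m := (M + 2, 0)) le_rfl le_rfl φ t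
  rw [norm_iteratedFDeriv_zero, Real.norm_eq_abs, abs_of_pos ht] at h
  rw [norm_mul, norm_mul, Complex.norm_real, Real.norm_of_nonneg (by positivity : 0 ≤ (1 + t) ^ M),
    Real.norm_of_nonneg ht.le]
  have h2 : (1 + t) ^ (-2 : ℝ) = ((1 + t) ^ 2)⁻¹ := by
    rw [Real.rpow_neg (by positivity)]; norm_cast
  rw [h2, mul_left_comm ((1 + t) ^ 2)⁻¹]
  refine mul_le_mul (g.norm_coe_le_norm _) ?_ (by positivity) (norm_nonneg _)
  rw [inv_mul_eq_div, le_div_iff₀ (by positivity)]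
  refine le_trans (le_of_eq ?_) h
  simp only [pow_add]
  ring

theorem integrableOn_one_add_norm_rpow :
    IntegrableOn (fun t : ℝ ↦ (1 + ‖t‖) ^ (-2 : ℝ)) (Set.Ioi 0) :=
  (integrable_one_add_norm (by simp)).integrableOn

theorem integrableOn_weightDist (M : ℕ) (g : ℝ →ᵇ ℂ) (φ : 𝓢(ℝ, ℂ)) :
    IntegrableOn (fun t : ℝ ↦ g (Real.log t) * (((1 + t) ^ M : ℝ) * φ t)) (Set.Ioi 0) := by
  refine Integrable.mono' (integrableOn_one_add_norm_rpow.mul_const _) ?_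
    ((ae_restrict_iff' measurableSet_Ioi).2 (.of_forall fun t ht ↦
      norm_weightDist_integrand_le M g φ ht))
  refine ((g.continuous.measurable.comp Real.measurable_log).mul ?_).aestronglyMeasurable
  exact ((Complex.continuous_ofReal.comp (by fun_prop)).mul φ.continuous).measurable

theorem norm_integral_weightDist_le (M : ℕ) (g : ℝ →ᵇ ℂ) (φ : 𝓢(ℝ, ℂ)) :
    ‖∫ t in Set.Ioi (0 : ℝ), g (Real.log t) * (((1 + t) ^ M : ℝ) * φ t)‖ ≤
      (∫ t in Set.Ioi (0 : ℝ), (1 + ‖t‖) ^ (-2 : ℝ)) * ‖g‖ * 2 ^ (M + 2) *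
        (Finset.Iic (M + 2, 0)).sup (schwartzSeminormFamily ℂ ℝ ℂ) φ := by
  rw [mul_assoc, mul_assoc, ← integral_mul_const]
  exact norm_integral_le_of_norm_le (integrableOn_one_add_norm_rpow.mul_const _)
    ((ae_restrict_iff' measurableSet_Ioi).2 (.of_forall fun t ht ↦
      norm_weightDist_integrand_le M g φ ht))

theorem integral_one_add_norm_rpow_nonneg :
    0 ≤ ∫ t in Set.Ioi (0 : ℝ), (1 + ‖t‖) ^ (-2 : ℝ) :=
  setIntegral_nonneg measurableSet_Ioi fun _ _ ↦ by positivity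

/-- The distribution `H(t) g(log t) (1 + t) ^ M`, for `g` bounded and continuous. -/
def weightDist (M : ℕ) : (ℝ →ᵇ ℂ) →ₗ[ℂ] TemperedPlus where
  toFun g := ⟨SchwartzMap.mkCLMtoNormedSpace (𝕜 := ℂ) (σ := RingHom.id ℂ)
    (fun φ : 𝓢(ℝ, ℂ) ↦ ∫ t in Set.Ioi (0 : ℝ), g (Real.log t) * (((1 + t) ^ M : ℝ) * φ t))
    (fun φ ψ ↦ by
      rw [← integral_add (integrableOn_weightDist M g φ) (integrableOn_weightDist M g ψ)]
      simp only [add_apply, mul_add])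
    (fun c φ ↦ by
      simp only [smul_apply, smul_eq_mul, RingHom.id_apply]
      rw [← integral_const_mul]
      congr 1 with x
      ring)
    ⟨_, _, mul_nonneg (mul_nonneg integral_one_add_norm_rpow_nonneg (norm_nonneg g))
      (by positivity), norm_integral_weightDist_le M g⟩,
    fun φ hφ ↦ setIntegral_eq_zero_of_forall_eq_zero fun x hx ↦ by
      rw [image_eq_zero_of_notMem_tsupport fun h ↦ lt_asymm (Set.mem_Ioi.1 hx) (hφ h), mul_zero,
        mul_zero]⟩
  map_add' g h := by
    ext φ
    refine Eq.trans ?_ (integral_add (integrableOn_weightDist M g φ) (integrableOn_weightDist M h φ))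
    refine integral_congr_ae (.of_forall fun t ↦ ?_)
    simp only [BoundedContinuousFunction.coe_add, Pi.add_apply, add_mul]
  map_smul' c g := by
    ext φ
    refine Eq.trans ?_ (integral_const_mul c _)
    refine integral_congr_ae (.of_forall fun t ↦ ?_)
    simp only [BoundedContinuousFunction.coe_smul, smul_eq_mul, mul_assoc]

/-- `convTest` as a linear map. -/
def convTestLM : (𝓢(ℝ, ℂ) →L[ℂ] ℂ) →ₗ[ℂ] (𝓢(ℝ, ℂ) →L[ℂ] 𝓢(ℝ, ℂ)) where
  toFun := convTest
  map_add' u v := by ext φ x; simp [convTest_apply, mul_add]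
  map_smul' c u := by ext φ x; simp [convTest_apply]; ring

/-- The convolution operators with the kernels `weightDist M g`. -/
def weightConv (M : ℕ) : (ℝ →ᵇ ℂ) →L[ℂ] (𝓢(ℝ, ℂ) →L[ℂ] 𝓢(ℝ, ℂ)) where
  toLinearMap := convTestLM ∘ₗ TemperedPlus.subtype ∘ₗ weightDist M
  cont := by
    refine continuous_of_convTest_bound _ fun p ↦ ?_
    obtain ⟨S, C, hC, h⟩ := seminorm_convTest_le_of_bound (Finset.Iic (M + 2, 0)) p
    set J := ∫ t in Set.Ioi (0 : ℝ), (1 + ‖t‖) ^ (-2 : ℝ)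
    have hJ : 0 ≤ J := integral_one_add_norm_rpow_nonneg
    refine ⟨S, J * 2 ^ (M + 2) * C, by positivity, fun g φ ↦ ?_⟩
    refine (h (weightDist M g).1 (J * ‖g‖ * 2 ^ (M + 2)) (by positivity)
      (norm_integral_weightDist_le M g) φ).trans (le_of_eq ?_)
    ring

/-! ### Holomorphy of the power kernel in its exponent -/

/-- The curve `z ↦ (s ↦ exp ((z - 1) s) (1 + exp s) ^ (-M))`: the power `t ^ (z - 1)` at `t = exp s`,
divided by the weight. -/
def powCurve (M : ℕ) (z : ℂ) (s : ℝ) : ℂ :=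
  exp ((z - 1) * s) * (((1 + Real.exp s) ^ M : ℝ) : ℂ)⁻¹

theorem exp_le_weight {M : ℕ} {r s : ℝ} (h0 : 0 ≤ r) (h1 : r ≤ M) :
    Real.exp (r * s) ≤ (1 + Real.exp s) ^ M := by
  have hs := Real.exp_pos s
  rcases le_total 0 s with h | h
  · calc Real.exp (r * s) ≤ Real.exp (M * s) := Real.exp_le_exp.2 (by gcongr)
      _ = Real.exp s ^ M := by rw [Real.exp_nat_mul]
      _ ≤ _ := by gcongr; linarith
  · calc Real.exp (r * s) ≤ 1 := Real.exp_le_one_iff.2 (mul_nonpos_of_nonneg_of_nonpos h0 h)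
      _ ≤ _ := one_le_pow₀ (by linarith)

theorem norm_powCurve (M : ℕ) (z : ℂ) (s : ℝ) :
    ‖powCurve M z s‖ = Real.exp ((z.re - 1) * s) / (1 + Real.exp s) ^ M := by
  have hs := Real.exp_pos s
  rw [powCurve, norm_mul, norm_inv, Complex.norm_real, Real.norm_of_nonneg (by positivity),
    Complex.norm_exp, div_eq_mul_inv]
  simp

/-- The margin of two units on both sides, `0 ≤ Re z - 1 - 2` and `Re z - 1 + 2 ≤ M`, leaves room
for a factor `exp (2 * |s|)`. This factor controls the Taylor remainder in
`differentiableAt_powBCF`. -/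
theorem norm_powCurve_mul_exp_le {M : ℕ} {z : ℂ} (h1 : 3 ≤ z.re) (h2 : z.re ≤ M - 1) (s : ℝ) :
    ‖powCurve M z s‖ * Real.exp (2 * |s|) ≤ 1 := by
  have hs := Real.exp_pos s
  rw [norm_powCurve, div_mul_eq_mul_div, div_le_one (by positivity), ← Real.exp_add]
  rcases abs_cases s with h | h
  · rw [h.1, ← add_mul]; exact exp_le_weight (by linarith) (by linarith)
  · rw [h.1, mul_neg, ← sub_eq_add_neg, ← sub_mul]
    exact exp_le_weight (by linarith) (by linarith)

theorem norm_powCurve_le {M : ℕ} {z : ℂ} (h1 : 1 ≤ z.re) (h2 : z.re ≤ M + 1) (s : ℝ) :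
    ‖powCurve M z s‖ ≤ 1 := by
  have hs := Real.exp_pos s
  rw [norm_powCurve, div_le_one (by positivity)]
  exact exp_le_weight (by linarith) (by linarith)

theorem continuous_powCurve (M : ℕ) (z : ℂ) : Continuous (powCurve M z) := by
  unfold powCurve
  refine Continuous.mul (by fun_prop) (Continuous.inv₀ (by fun_prop) fun s ↦ ?_)
  have := Real.exp_pos s
  exact_mod_cast (by positivity : (0 : ℝ) < (1 + Real.exp s) ^ M).ne'

open Classical in
/-- `powCurve M z` as a bounded continuous function (and `0` if it is unbounded). -/
def powBCF (M : ℕ) (z : ℂ) : ℝ →ᵇ ℂ :=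
  if h : ∀ s, ‖powCurve M z s‖ ≤ 1 then
    BoundedContinuousFunction.ofNormedAddCommGroup (powCurve M z) (continuous_powCurve M z) 1 h
  else 0

theorem powBCF_apply {M : ℕ} {z : ℂ} (h1 : 1 ≤ z.re) (h2 : z.re ≤ M + 1) (s : ℝ) :
    powBCF M z s = powCurve M z s := by
  rw [powBCF, dif_pos (norm_powCurve_le h1 h2)]; rfl

theorem powCurve_add (M : ℕ) (z h : ℂ) (s : ℝ) :
    powCurve M (z + h) s = powCurve M z s * exp (h * s) := by
  rw [powCurve, powCurve, mul_right_comm, ← Complex.exp_add]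
  ring_nf

theorem differentiableAt_powBCF {M : ℕ} {z : ℂ} (h1 : 3 ≤ z.re) (h2 : z.re ≤ M - 1) :
    DifferentiableAt ℂ (powBCF M) z := by
  have hb (s : ℝ) : ‖(s : ℂ) * powCurve M z s‖ ≤ 1 := by
    refine le_trans ?_ (norm_powCurve_mul_exp_le h1 h2 s)
    rw [norm_mul, Complex.norm_real, mul_comm, Real.norm_eq_abs]
    gcongr
    have := Real.add_one_le_exp (2 * |s|)
    linarith [abs_nonneg s]
  -- The candidate derivative: differentiating `exp ((z - 1) * s)` in `z` multiplies it by `s`.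
  let G : ℝ →ᵇ ℂ := BoundedContinuousFunction.ofNormedAddCommGroup
    (fun s : ℝ ↦ (s : ℂ) * powCurve M z s)
    (Complex.continuous_ofReal.mul (continuous_powCurve M z)) 1 hb
  suffices h : HasDerivAt (powBCF M) G z from h.differentiableAt
  rw [hasDerivAt_iff_isLittleO_nhds_zero]
  refine Asymptotics.IsBigO.trans_isLittleO (g := fun h : ℂ ↦ h ^ 2) ?_ ?_
  · refine Asymptotics.IsBigO.of_bound 2 ?_
    filter_upwards [Metric.closedBall_mem_nhds (0 : ℂ) one_pos] with h hh
    have hh' : ‖h‖ ≤ 1 := by simpa using hh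
    -- Since `|Re h| ≤ 1`, the point `z + h` stays in the range where `powBCF` is the true curve and
    -- not its default value `0`.
    have hre := abs_le.1 ((Complex.abs_re_le_norm h).trans hh')
    refine (BoundedContinuousFunction.norm_le (by positivity)).2 fun s ↦ ?_
    have e : (powBCF M (z + h) - powBCF M z - h • G) s =
        powCurve M z s * (exp (h * s) - 1 - h * s) := by
      simp only [BoundedContinuousFunction.coe_sub, Pi.sub_apply, BoundedContinuousFunction.coe_smul]
      rw [powBCF_apply (by simp; linarith) (by simp; linarith),
        powBCF_apply (by linarith) (by linarith), powCurve_add]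
      simp only [G, BoundedContinuousFunction.coe_ofNormedAddCommGroup, smul_eq_mul]
      ring
    -- The remainder is at most `|h * s| ^ 2 * exp |h * s|`. One factor `exp |s|` bounds `|s| ^ 2 /
    -- 2`, the other bounds the exponential as `‖h‖ ≤ 1`.
    have e2 : ‖exp (h * s) - 1 - h * s‖ ≤ ‖h‖ ^ 2 * (2 * Real.exp (2 * |s|)) := by
      have := Complex.norm_exp_sub_sum_le_norm_mul_exp (h * s) 2
      simp only [Finset.sum_range_succ, Finset.sum_range_zero, pow_zero, pow_one,
        Nat.factorial, Nat.cast_one, div_one, zero_add, mul_one, ← sub_sub] at this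
      refine this.trans ?_
      have hn : ‖h * s‖ = ‖h‖ * |s| := by rw [norm_mul, Complex.norm_real, Real.norm_eq_abs]
      have hle : ‖h‖ * |s| ≤ |s| := mul_le_of_le_one_left (abs_nonneg s) hh'
      have hq := Real.quadratic_le_exp_of_nonneg (abs_nonneg s)
      have hs2 : |s| ^ 2 ≤ 2 * Real.exp |s| := by linarith [abs_nonneg s]
      rw [hn, mul_pow, mul_assoc]
      refine mul_le_mul_of_nonneg_left ?_ (by positivity)
      calc |s| ^ 2 * Real.exp (‖h‖ * |s|) ≤ 2 * Real.exp |s| * Real.exp |s| := by gcongr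
        _ = _ := by rw [mul_assoc, ← Real.exp_add]; ring_nf
    rw [e, norm_mul, norm_pow]
    calc _ ≤ ‖powCurve M z s‖ * (‖h‖ ^ 2 * (2 * Real.exp (2 * |s|))) := by gcongr
      _ = 2 * ‖h‖ ^ 2 * (‖powCurve M z s‖ * Real.exp (2 * |s|)) := by ring
      _ ≤ 2 * ‖h‖ ^ 2 * 1 := by gcongr; exact norm_powCurve_mul_exp_le h1 h2 s
      _ = _ := mul_one _
  · simpa using Asymptotics.isLittleO_pow_pow (𝕜 := ℂ) (m := 1) (n := 2) (by norm_num)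

/-- The kernel `t ^ (z - 1) / Γ(z)`, in the variable `log t` and divided by the weight. -/
def kernelCurve (M : ℕ) (z : ℂ) : ℝ →ᵇ ℂ := (Gamma z)⁻¹ • powBCF M z

theorem differentiableAt_kernelCurve {M : ℕ} {z : ℂ} (h1 : 3 ≤ z.re) (h2 : z.re ≤ M - 1) :
    DifferentiableAt ℂ (kernelCurve M) z :=
  (Complex.differentiable_one_div_Gamma z).smul (differentiableAt_powBCF h1 h2)

/-- On `t > 0`, `exp (log t) = t`, so the weight in `weightDist` cancels the one divided out in
`powCurve`. -/
theorem weightDist_kernelCurve {M : ℕ} {β : ℝ} (h0 : 1 ≤ β) (h2 : β ≤ M + 1) :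
    weightDist M (kernelCurve M β) = fracKernel β := by
  have hβ : 0 < β := by linarith
  rw [fracKernel, dif_pos hβ]
  ext φ
  refine setIntegral_congr_fun measurableSet_Ioi fun t ht ↦ ?_
  have ht : 0 < t := ht
  have h1t : (((1 + t) ^ M : ℝ) : ℂ) ≠ 0 :=
    Complex.ofReal_ne_zero.2 (by positivity)
  have e : kernelCurve M β (Real.log t) =
      (Gamma β)⁻¹ * (((t ^ (β - 1) : ℝ) : ℂ) * (((1 + t) ^ M : ℝ) : ℂ)⁻¹) := by
    simp only [kernelCurve, BoundedContinuousFunction.coe_smul, smul_eq_mul]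
    rw [powBCF_apply (by simpa using h0) (by simpa using h2), powCurve, Real.exp_log ht,
      Real.rpow_def_of_pos ht]
    push_cast
    ring_nf
  rw [e, Complex.Gamma_ofReal, Complex.ofReal_div]
  field_simp

/-! ### Derivatives of the kernels and of convolutions -/

/-- Integration by parts on `(0, ∞)` together with `Γ(β + 1) = β Γ(β)`. The boundary term at `0`
vanishes because `β > 0`. -/
theorem distDeriv_powDist {β : ℝ} (hβ : 0 < β) :
    distDeriv (powDist (β + 1) (by linarith)) = powDist β hβ := by
  ext φ
  change -∫ t in Set.Ioi (0 : ℝ), ((t ^ (β + 1 - 1) / Real.Gamma (β + 1) : ℝ) : ℂ) * deriv φ t =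
    ∫ t in Set.Ioi (0 : ℝ), ((t ^ (β - 1) / Real.Gamma β : ℝ) : ℂ) * φ t
  have i0 := integrableOn_rpow_mul (α := β + 1) (by linarith) φ
  have i1 := integrableOn_rpow_mul (α := β + 1) (by linarith) (SchwartzMap.derivCLM ℂ ℂ φ)
  have i2 := (integrableOn_rpow_mul hβ φ).const_mul (β : ℂ)
  simp only [add_sub_cancel_right] at i0 i1
  simp only [SchwartzMap.derivCLM_apply] at i1
  have hderiv (t : ℝ) (ht : t ∈ Set.Ioi (0 : ℝ)) :
      HasDerivAt (fun t : ℝ ↦ ((t ^ β : ℝ) : ℂ) * φ t)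
        ((β : ℂ) * (((t ^ (β - 1) : ℝ) : ℂ) * φ t) + ((t ^ β : ℝ) : ℂ) * deriv φ t) t := by
    have h1 := (Real.hasDerivAt_rpow_const (x := t) (p := β) (Or.inl (ne_of_gt ht))).ofReal_comp
    have h2 : HasDerivAt φ (deriv φ t) t := φ.hasDerivAt t
    refine (h1.mul h2).congr_deriv ?_
    push_cast
    ring
  have hint := i2.add i1
  -- The boundary term at infinity vanishes because `t ^ β * φ t` and its derivative are both
  -- integrable.
  have hlim := tendsto_zero_of_hasDerivAt_of_integrableOn_Ioi hderiv hint i0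
  have hcont : Continuous fun t : ℝ ↦ ((t ^ β : ℝ) : ℂ) * φ t :=
    (Complex.continuous_ofReal.comp (Real.continuous_rpow_const hβ.le)).mul φ.continuous
  have key := integral_Ioi_of_hasDerivAt_of_tendsto hcont.continuousWithinAt hderiv hint hlim
  rw [integral_add i2 i1, integral_const_mul, Real.zero_rpow hβ.ne'] at key
  have key' := eq_neg_of_add_eq_zero_right (key.trans (by simp))
  have hΓ : ((Real.Gamma β : ℝ) : ℂ) ≠ 0 := Complex.ofReal_ne_zero.2 (Real.Gamma_pos_of_pos hβ).ne'
  have hβ' : (β : ℂ) ≠ 0 := Complex.ofReal_ne_zero.2 hβ.ne'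
  have h1 := integral_kernel_eq (β + 1) (SchwartzMap.derivCLM ℂ ℂ φ)
  simp only [SchwartzMap.derivCLM_apply, add_sub_cancel_right] at h1
  rw [integral_kernel_eq, add_sub_cancel_right, h1, key', Real.Gamma_add_one hβ.ne']
  push_cast
  field_simp

theorem distDeriv_fracKernel (β : ℝ) : distDeriv (fracKernel (β + 1)) = fracKernel β := by
  rcases lt_or_ge 0 β with hβ | hβ
  · rw [fracKernel, fracKernel, dif_pos hβ, dif_pos (by linarith), distDeriv_powDist hβ]
  rcases lt_or_ge 0 (β + 1) with h1 | h1
  -- Here `-1 < β ≤ 0`, and the definition of `f_β` is a single derivative of `f_{β+1}`.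
  · have hfl : ⌊-β⌋₊ = 0 := Nat.floor_eq_zero.2 (by linarith)
    rw [fracKernel, fracKernel, dif_neg hβ.not_gt, dif_pos h1]
    simp [hfl]
  -- Both kernels are iterated derivatives of the same power; `f_β` takes exactly one derivative
  -- more.
  · have hfl : ⌊-β⌋₊ = ⌊-(β + 1)⌋₊ + 1 := by
      rw [← Nat.floor_add_one (by linarith)]; congr 1; ring
    rw [fracKernel, fracKernel, dif_neg hβ.not_gt, dif_neg h1.not_gt]
    simp only [hfl, Function.iterate_succ_apply' distDeriv (⌊-(β + 1)⌋₊ + 1)]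
    congr 3
    push_cast
    ring

/-- This is the independence of `f_β` from the choice of `N`; it allows one `N` to serve for a whole
interval of exponents. -/
theorem iterate_distDeriv_fracKernel (β : ℝ) (N : ℕ) :
    distDeriv^[N] (fracKernel (β + N)) = fracKernel β := by
  induction N with
  | zero => simp
  | succ N ih =>
    rw [Function.iterate_succ_apply, Nat.cast_succ, ← add_assoc, distDeriv_fracKernel, ih]

/-- On `𝒮'₊`, differentiation commutes with `slice`, as the cutoff is constant near `[0, ∞)`. -/
theorem apply_derivCLM_slice (u : TemperedPlus) (x : ℝ) (φ : 𝓢(ℝ, ℂ)) :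
    u.1 (SchwartzMap.derivCLM ℂ ℂ (slice x φ)) = u.1 (slice x (SchwartzMap.derivCLM ℂ ℂ φ)) := by
  rw [← sub_eq_zero, ← map_sub]
  -- The two test functions agree on `(-1, ∞)`, where the cutoff is `1`, so their difference is
  -- invisible to `u`.
  refine u.2 _ (Set.Subset.trans (closure_minimal (t := Set.Iic (-1)) ?_ isClosed_Iic)
    (Set.Iic_subset_Iio.2 (by norm_num)))
  intro t ht
  by_contra ht'
  rw [Set.mem_Iic, not_le] at ht'
  refine ht ?_
  rw [sub_apply, slice_apply, SchwartzMap.derivCLM_apply, SchwartzMap.derivCLM_apply,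
    cutoff_eq_one ht'.le, one_mul, ← deriv_comp_const_add, sub_eq_zero]
  refine Filter.EventuallyEq.deriv_eq ?_
  filter_upwards [Ioi_mem_nhds ht'] with s hs
  rw [slice_apply, cutoff_eq_one (le_of_lt hs), one_mul]

theorem convTest_distDeriv (u : TemperedPlus) :
    convTest (distDeriv u).1 = convTest u.1 ∘L (-SchwartzMap.derivCLM ℂ ℂ) := by
  ext φ x
  simp [convTest_apply, distDeriv, apply_derivCLM_slice]

theorem convTest_iterate_distDeriv (u : TemperedPlus) (N : ℕ) :
    convTest (distDeriv^[N] u).1 = convTest u.1 ∘L (-SchwartzMap.derivCLM ℂ ℂ) ^ N := by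
  induction N with
  | zero => rfl
  | succ N ih =>
    rw [Function.iterate_succ_apply', convTest_distDeriv, ih, pow_succ]; rfl

/-! ### Smooth dependence on the order -/

/-- The continuous linear map `g ↦ (weightDist M g)^(N) * ·` on test functions. -/
def weightConvDeriv (M N : ℕ) : (ℝ →ᵇ ℂ) →L[ℂ] (𝓢(ℝ, ℂ) →L[ℂ] 𝓢(ℝ, ℂ)) :=
  ContinuousLinearMap.precomp 𝓢(ℝ, ℂ) ((-SchwartzMap.derivCLM ℂ ℂ) ^ N) ∘L weightConv M

theorem weightConvDeriv_apply (M N : ℕ) (g : ℝ →ᵇ ℂ) :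
    weightConvDeriv M N g = convTest (distDeriv^[N] (weightDist M g)).1 := by
  rw [convTest_iterate_distDeriv]; rfl

/-- The vertical strip in which `kernelCurve M (N - z)` is holomorphic. -/
def strip (M N : ℕ) : Set ℂ := {z | 3 < N - z.re ∧ N - z.re < M - 1}

theorem isOpen_strip (M N : ℕ) : IsOpen (strip M N) :=
  (isOpen_lt (f := fun _ ↦ (3 : ℝ)) (g := fun z : ℂ ↦ N - z.re) (by fun_prop) (by fun_prop)).inter
    (isOpen_lt (f := fun z : ℂ ↦ N - z.re) (g := fun _ ↦ (M : ℝ) - 1) (by fun_prop) (by fun_prop))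

theorem exists_mem_strip (t : ℝ) : ∃ M N : ℕ, (t : ℂ) ∈ strip M N := by
  obtain ⟨N, hN⟩ := exists_nat_gt (t + 3)
  obtain ⟨M, hM⟩ := exists_nat_gt (N - t + 1)
  exact ⟨M, N, by simp; linarith, by simp; linarith⟩

theorem differentiableOn_kernelCurve (M N : ℕ) :
    DifferentiableOn ℂ (fun z ↦ kernelCurve M (N - z)) (strip M N) := fun z hz ↦
  (DifferentiableAt.comp (g := kernelCurve M) z
    (differentiableAt_kernelCurve (by simpa using hz.1.le) (by simpa using hz.2.le))
    (by fun_prop)).differentiableWithinAt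

theorem iterate_distDeriv_weightDist {M N : ℕ} {t : ℝ} (ht : (t : ℂ) ∈ strip M N) :
    distDeriv^[N] (weightDist M (kernelCurve M (N - t))) = fracKernel (-t) := by
  obtain ⟨h1, h2⟩ := ht
  rw [ofReal_re] at h1 h2
  rw [← iterate_distDeriv_fracKernel (-t) N, ← weightDist_kernelCurve (M := M) (by linarith)
    (by linarith)]
  push_cast
  ring_nf

theorem weightConvDeriv_kernelCurve {M N : ℕ} {t : ℝ} (ht : (t : ℂ) ∈ strip M N) :
    weightConvDeriv M N (kernelCurve M (N - t)) = convTest (fracKernel (-t)).1 := by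
  rw [weightConvDeriv_apply, iterate_distDeriv_weightDist ht]

/-- Near each point the curve is the image under `weightConvDeriv M N` of a holomorphic, hence
continuous, curve. Convergence holds for operators, uniformly on bounded sets, as joint continuity
requires. -/
theorem continuous_convTest_fracKernel :
    Continuous fun α : ℝ ↦ convTest (fracKernel (-α)).1 := by
  refine continuous_iff_continuousAt.2 fun t ↦ ?_
  obtain ⟨M, N, ht⟩ := exists_mem_strip t
  have hV := (isOpen_strip M N).preimage Complex.continuous_ofReal
  have hc : ContinuousAt (fun s : ℝ ↦ weightConvDeriv M N (kernelCurve M (N - s))) t := by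
    refine (weightConvDeriv M N).continuous.continuousAt.comp ?_
    exact ContinuousAt.comp (f := ((↑) : ℝ → ℂ)) (g := fun z ↦ kernelCurve M (N - z))
      ((differentiableOn_kernelCurve M N).continuousOn.continuousAt
        ((isOpen_strip M N).mem_nhds ht)) Complex.continuous_ofReal.continuousAt
  refine hc.congr ?_
  filter_upwards [hV.mem_nhds ht] with s hs using weightConvDeriv_kernelCurve hs

/-- The continuous linear map `g ↦ (weightDist M g)^(N) * y`. -/
def weightConvCLM (M N : ℕ) (y : TemperedPlus) : (ℝ →ᵇ ℂ) →L[ℂ] TemperedPlus :=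
  ((ContinuousLinearMap.postcomp 𝓢(ℝ, ℂ) y.1) ∘L weightConvDeriv M N).codRestrict TemperedPlus
    fun g ↦ by
      rw [ContinuousLinearMap.comp_apply, weightConvDeriv_apply]
      exact comp_convTest_mem (distDeriv^[N] (weightDist M g)).2 y.2

theorem weightConvCLM_kernelCurve {M N : ℕ} (y : TemperedPlus) {t : ℝ}
    (ht : (t : ℂ) ∈ strip M N) :
    weightConvCLM M N y (kernelCurve M (N - t)) = fracDeriv t y := by
  refine Subtype.ext ?_
  change y.1 ∘L weightConvDeriv M N (kernelCurve M (N - t)) = _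
  rw [weightConvDeriv_kernelCurve ht]; rfl

theorem smoothCurve_fracDeriv (y : TemperedPlus) :
    SmoothCurve fun α : ℝ ↦ fracDeriv α y := by
  refine .of_locally fun t ↦ ?_
  obtain ⟨M, N, ht⟩ := exists_mem_strip t
  refine ⟨_, (isOpen_strip M N).preimage Complex.continuous_ofReal, ht,
    fun n s ↦ (weightConvCLM M N y).restrictScalars ℝ
      (deriv^[n] (fun z ↦ kernelCurve M (N - z)) s),
    fun s hs ↦ weightConvCLM_kernelCurve y hs, fun n s hs ↦ ?_⟩
  exact tendsto_slope_map_iterate_deriv _ (isOpen_strip M N) (differentiableOn_kernelCurve M N) n hs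

/-! ### Continuity in the distribution, and joint continuity -/

/-- A continuous operator maps bounded sets to bounded sets, so its transpose is continuous for the
strong topology. -/
theorem continuous_fracDeriv (α : ℝ) : Continuous (fracDeriv α) :=
  ((ContinuousLinearMap.precomp ℂ (convTest (fracKernel (-α)).1)).continuous.comp
    continuous_subtype_val).subtype_mk _

theorem isLinearMap_fracDeriv (α : ℝ) : IsLinearMap ℂ (fracDeriv α) :=
  ⟨fun _ _ ↦ rfl, fun _ _ ↦ rfl⟩

/-- Composition `(A, u) ↦ u ∘ A` is jointly continuous along a curve of operators, as the image of
a bounded set under a compact set of operators is bounded. -/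
theorem continuous_comp_curve {E F : Type*} [AddCommGroup E] [Module ℂ E] [TopologicalSpace E]
    [IsTopologicalAddGroup E] [ContinuousSMul ℂ E] {T : ℝ → E →L[ℂ] E} (hT : Continuous T)
    [AddCommGroup F] [Module ℂ F] [TopologicalSpace F] [IsTopologicalAddGroup F]
    [ContinuousSMul ℂ F] :
    Continuous fun p : ℝ × (E →L[ℂ] F) ↦ p.2 ∘L T p.1 := by
  refine continuous_iff_continuousAt.2 fun ⟨t, u⟩ ↦ ?_
  -- Split `v ∘ T s = (v - u) ∘ T s + u ∘ T s`. Only the first term has both factors moving; the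
  -- second is continuous in `s` by continuity of `T`.
  have h1 : Tendsto (fun p : ℝ × (E →L[ℂ] F) ↦ (p.2 - u) ∘L T p.1) (𝓝 (t, u)) (𝓝 0) := by
    rw [ContinuousLinearMap.hasBasis_nhds_zero.tendsto_right_iff]
    rintro ⟨B, U⟩ ⟨hB, hU⟩
    have hK : Bornology.IsVonNBounded ℂ (T '' Metric.closedBall t 1) :=
      ((isCompact_closedBall t 1).image hT).isVonNBounded ℂ
    -- All `T s φ` with `|s - t| ≤ 1` and `φ ∈ B` lie in this single bounded set, on which `v - u`
    -- is uniformly small.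
    have hKB := ContinuousLinearMap.isVonNBounded_image2_apply hK hB
    have hsub : Tendsto (fun p : ℝ × (E →L[ℂ] F) ↦ p.2 - u) (𝓝 (t, u)) (𝓝 0) := by
      have : Continuous fun p : ℝ × (E →L[ℂ] F) ↦ p.2 - u := by fun_prop
      simpa using this.tendsto (t, u)
    have hev := ContinuousLinearMap.hasBasis_nhds_zero.tendsto_right_iff.1 hsub (_, U) ⟨hKB, hU⟩
    filter_upwards [hev, (continuous_fst.tendsto (t, u)).eventually
      (Metric.closedBall_mem_nhds t one_pos)] with p hp hpt φ hφ
    exact hp _ (Set.mem_image2_of_mem (Set.mem_image_of_mem T hpt) hφ)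
  have h2 : Tendsto (fun p : ℝ × (E →L[ℂ] F) ↦ u ∘L T p.1) (𝓝 (t, u)) (𝓝 (u ∘L T t)) :=
    (((ContinuousLinearMap.postcomp E u).continuous.comp hT).comp continuous_fst).tendsto (t, u)
  have h3 := h1.add h2
  rw [zero_add] at h3
  refine h3.congr fun p ↦ ?_
  ext φ
  simp

theorem continuous_uncurry_fracDeriv :
    Continuous fun p : ℝ × TemperedPlus ↦ fracDeriv p.1 p.2 :=
  ((continuous_comp_curve continuous_convTest_fracKernel).comp
    (continuous_fst.prodMk (continuous_subtype_val.comp continuous_snd))).subtype_mk _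

end

end FracDeriv

theorem proposition1 :
    (∀ α : ℝ, IsLinearMap ℂ (FracDeriv.fracDeriv α) ∧ Continuous (FracDeriv.fracDeriv α)) ∧
    (∀ y : FracDeriv.TemperedPlus,
      FracDeriv.SmoothCurve (fun α : ℝ ↦ FracDeriv.fracDeriv α y)) ∧
    Continuous (fun p : ℝ × FracDeriv.TemperedPlus ↦ FracDeriv.fracDeriv p.1 p.2) := by
  exact ⟨fun α ↦ ⟨FracDeriv.isLinearMap_fracDeriv α, FracDeriv.continuous_fracDeriv α⟩,
    FracDeriv.smoothCurve_fracDeriv, FracDeriv.continuous_uncurry_fracDeriv⟩
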